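/- Let $1\le k<n$, $\epsilon_i=1$ for $i\le n-k$, $\epsilon_i=-1$ for $i>n-k$, $J=\operatorname{diag}(\epsilon_1,\dots,\epsilon_n)$. **Combescure sequences.** An immersion $f:O\to\mathbb R^{n+1}$ of an open set $O\subseteq\mathbb R^n$ is an isothermic$_k$ hypersurface if $x_1,\dots,x_n$ are line of curvature co-ordinates (both fundamental forms are diagonal) and $\sum_i\epsilon_i|f_{x_i}|^2=0$. A Combescure sequence is a family $f=\{f_1,\dots,f_n\}$ of isothermic$_k$ hypersurfaces on a common simply connected open set $O$ such that $(f_l)_{x_i}\parallel(f_{l+1})_{x_i}$ for all $l,i$, and such that there are metric fields $u_l=(u_{l1},\dots,u_{ln})$, $u_{li}^2=|(f_l)_{x_i}|^2$, with $(f_l)_{x_i}/u_{li}$ independent of $l$ and $u_1,\dots,u_n$ linearly independent at every point. **Lie transform.** For $r>0$, $S_rf=\{\tilde f_1,\dots,\tilde f_n\}$ with $\tilde f_l(x)=r f_l(r^{-1}x)$, defined on $rO$. **Extended frames.** For $\xi=(F,\gamma)\in\mathcal M_{n\times(n+1)}(\mathbb R)$ with $F_{ii}=0$ put $v_\xi=\begin{pmatrix}0&-\xi^TJ\\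 \xi&0\end{pmatrix}$, let $a_i=v_{(e_{ii},0)}$, and let $\xi:O\to\mathcal M_{n\times(n+1)}(\mathbb R)$ be a smooth solution of $[a_i,(v_\xi)_{x_j}]-[a_j,(v_\xi)_{x_i}]-[[a_i,v_\xi],[a_j,v_\xi]]=0$ ($i\ne j$). Put $\rho=\operatorname{diag}(I_{n+1},-I_n)$ and let $(\cdot,\cdot)$ be the complex bilinear form on $\mathbb C^{2n+1}$ with matrix $\operatorname{diag}(I_{n+1},J)$. An extended frame is a smooth map $E(x,\lambda)$, entire in $\lambda$, with values in the complex orthogonal group of $(\cdot,\cdot)$, with $E^{-1}dE=\sum_i(\lambda a_i+[a_i,v_\xi])dx_i$, $\overline{E(x,\bar\lambda)}=E(x,\lambda)$ and $\rho E(x,-\lambda)\rho=E(x,\lambda)$. Write $Y_E(x)$ for the upper right $(n+1)\times n$ block of $\frac{\partial E}{\partial\lambda}E^{-1}|_{\lambda=0}$. **Ribaucour transform.** Let $\alpha\in\mathbb C\setminus\{0\}$ and let $\ell$ be an isotropic line with either $\alpha\in\mathbb R$, $\ell\subset\mathbb R^{n+1}\oplus\mathbb R^{n}$, or $\alpha\in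 i\mathbb R$, $\ell\subset\mathbb R^{n+1}\oplus i\mathbb R^{n}$; let $L=\ell^{\mathbb C}$ and assume $\rho L\ne L$. Such a pair $(\alpha,L)$ is called admissible. Let $$p_{\alpha,L}(\lambda)=\tfrac{\lambda-\alpha}{\lambda+\alpha}\pi_L+\pi_{(L\oplus\rho L)^\perp}+\tfrac{\lambda+\alpha}{\lambda-\alpha}\pi_{\rho L},$$ where $\pi_L$, $\pi_{\rho L}$ and $\pi_{(L\oplus\rho L)^\perp}$ are the projections of the decomposition $\mathbb C^{2n+1}=L\oplus\rho L\oplus(L\oplus\rho L)^\perp$. Fix $h\in \mathrm O(n+1)$ (the initial frame; $h=I$ for normalised frames). Let $f$ be a Combescure sequence on $O\ni0$ and suppose $f_l=f_l(0)+Y_Ec_l$ on $O$, where $\{c_1,\dots,c_n\}$ is a basis of $\mathbb R^n$ consisting of null vectors for $J$ and $E$ is an extended frame of a solution $\xi$ on $O$ with $E(0,\lambda)=\operatorname{diag}(h,I_n)$ for all $\lambda$. Put $\tilde L(x)=E(x,\alpha)^{-1}L$ and $\tilde E(x,\lambda)=E(x,\lambda)\,p_{\alpha,\tilde L(x)}(\lambda)^{-1}$.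 Then $R_{\alpha,L}f=\{\tilde f_1,\dots,\tilde f_n\}$ with $\tilde f_l=f_l(0)+Y_{\tilde E}c_l$. Here $R_{\alpha,L}$ is regarded as a partially defined transformation of Combescure sequences: its values are the Combescure sequences given by this formula over simply connected open subsets of $O$ on which $\rho\tilde L(x)\neq\tilde L(x)$. **Statement.** Let $r>0$, let $(\alpha,L)$ be admissible, let $h\in\mathrm O(n+1)$, and let $f$ be a Combescure sequence on $O\ni 0$. Then $S_rf$ is a Combescure sequence, $(r^{-1}\alpha,L)$ is admissible, and $$S_r\circ R_{\alpha,L}\circ S_{r^{-1}}=R_{r^{-1}\alpha,L}$$ at $f$, as partially defined transformations (same values over the same domains). Moreover $R_{\alpha,L}$ is single valued: any two values of $R_{\alpha,L}f$ agree on the intersection of their domains. -/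

import Mathlib

open scoped ContDiff Matrix

noncomputable section

/-- Euclidean `m`-space. -/
abbrev Euc (m : ℕ) : Type := EuclideanSpace ℝ (Fin m)

/-- The partial derivative `∂f/∂xᵢ` at `x`. -/
def pd {n : ℕ} {V : Type*} [NormedAddCommGroup V] [NormedSpace ℝ V]
    (f : Euc n → V) (i : Fin n) (x : Euc n) : V :=
  fderiv ℝ f x (EuclideanSpace.single i (1 : ℝ))

/-- The signs `ε₁ = ⋯ = ε_{n-k} = 1`, `ε_{n-k+1} = ⋯ = ε_n = -1`. -/
def sgnK {n : ℕ} (k : ℕ) (i : Fin n) : ℝ := if (i : ℕ) + k < n then 1 else -1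

/-- `J = I_{n-k,k} = diag(ε₁, …, ε_n)`, the Gram matrix of `ℝ^{n-k,k}`. -/
def matJ (n k : ℕ) : Matrix (Fin n) (Fin n) ℝ := Matrix.diagonal (sgnK k)

/-! ### Isothermic hypersurfaces and Combescure sequences -/

/-- `f` is an immersed isothermic_k hypersurface in `ℝ^{n+1}` parametrised over `O` by line of
curvature co-ordinates whose induced metric is Guichard_k. Both fundamental forms are diagonal;
the second one is tested against every vector `ν` normal to the hypersurface at `x`. -/
structure IsIsothermic {n : ℕ} (k : ℕ) (O : Set (Euc n)) (f : Euc n → Euc (n + 1)) : Prop where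
  smooth : ContDiffOn ℝ ∞ f O
  immersion : ∀ x ∈ O, LinearIndependent ℝ (fun i => pd f i x)
  orthogonal : ∀ x ∈ O, ∀ i j, i ≠ j → inner ℝ (pd f i x) (pd f j x) = 0
  curvature : ∀ x ∈ O, ∀ ν : Euc (n + 1), (∀ m, inner ℝ (pd f m x) ν = 0) →
    ∀ i j, i ≠ j → inner ℝ (pd (pd f i) j x) ν = 0
  guichard : ∀ x ∈ O, ∑ i, sgnK k i * ‖pd f i x‖ ^ 2 = 0

/-- `f(x) ↦ g(x)` is a Combescure transform: `f_{x_i}` and `g_{x_i}` are parallel for all `i`. -/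
def IsCombescureTransform {n : ℕ} (O : Set (Euc n)) (f g : Euc n → Euc (n + 1)) : Prop :=
  ∀ x ∈ O, ∀ i, ∃ c : ℝ, c ≠ 0 ∧ pd g i x = c • pd f i x

/-- `u = (u₁, …, u_n)` is a metric field for the induced metric `∑ uⱼ² dxⱼ²` of `f`. -/
structure IsMetricField {n : ℕ} (O : Set (Euc n)) (f : Euc n → Euc (n + 1))
    (u : Euc n → Fin n → ℝ) : Prop where
  smooth : ContDiffOn ℝ ∞ u O
  sq_eq : ∀ x ∈ O, ∀ j, u x j ^ 2 = ‖pd f j x‖ ^ 2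

/-- A sequence of `n` maps into `ℝ^{n+1}` with a common parameter domain
(only the values on the domain matter). -/
@[ext]
structure HSeq (n : ℕ) where
  domain : Set (Euc n)
  map : Fin n → Euc n → Euc (n + 1)

/-- `{f₁, …, f_n}` is a Combescure sequence of isothermic_k hypersurfaces in `ℝ^{n+1}`,
defined on a simply connected open set. -/
structure IsCombescure {n : ℕ} (k : ℕ) (f : HSeq n) : Prop where
  isOpen : IsOpen f.domain
  simplyConnected : SimplyConnectedSpace f.domain
  isothermic : ∀ l, IsIsothermic k f.domain (f.map l)
  combescure : ∀ l m : Fin n, (m : ℕ) = l + 1 →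
    IsCombescureTransform f.domain (f.map l) (f.map m)
  independent : ∃ u : Fin n → Euc n → Fin n → ℝ,
    (∀ l, IsMetricField f.domain (f.map l) (u l)) ∧
    (∀ x ∈ f.domain, ∀ l m j,
      (u l x j)⁻¹ • pd (f.map l) j x = (u m x j)⁻¹ • pd (f.map m) j x) ∧
    ∀ x ∈ f.domain, LinearIndependent ℝ (fun l => u l x)

/-- The Lie transform `S_r`: `f_l(x) ↦ r f_l(r⁻¹ x)`. -/
def lieTransform {n : ℕ} (r : ℝ) (f : HSeq n) : HSeq n where
  domain := {x | r⁻¹ • x ∈ f.domain}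
  map l x := r • f.map l (r⁻¹ • x)

/-! ### The `O(2n+1-k,k) / (O(n+1) × O(n-k,k))`-system and its extended frames -/

/-- Index set of `ℝ^{2n+1-k,k} = ℝ^{n+1} ⊕ ℝ^{n-k,k}`. -/
abbrev Idx (n : ℕ) : Type := Fin (n + 1) ⊕ Fin n

/-- The element of `𝔭` with lower left block `ξ`. -/
def pElem {n : ℕ} (k : ℕ) (ξ : Matrix (Fin n) (Fin (n + 1)) ℝ) : Matrix (Idx n) (Idx n) ℝ :=
  Matrix.fromBlocks 0 (-(ξᵀ * matJ n k)) ξ 0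

/-- The basis `a₁, …, a_n` of the maximal abelian subalgebra: `ξ = (e_{ii}, 0)`. -/
def aElem {n : ℕ} (k : ℕ) (i : Fin n) : Matrix (Idx n) (Idx n) ℝ :=
  pElem k (Matrix.single i i.castSucc 1)

/-- `ξ = (F, γ)` (with `F` of zero diagonal, `γ` the last column) is a smooth solution on `O` of
`[aᵢ, v_{xⱼ}] - [aⱼ, v_{xᵢ}] - [[aᵢ, v], [aⱼ, v]] = 0`, `i ≠ j`, where `v = pElem k ξ`. -/
structure IsSolution {n : ℕ} (k : ℕ) (O : Set (Euc n))
    (ξ : Euc n → Matrix (Fin n) (Fin (n + 1)) ℝ) : Prop where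
  smooth : ∀ a b, ContDiffOn ℝ ∞ (fun x => ξ x a b) O
  diag : ∀ x ∈ O, ∀ i, ξ x i i.castSucc = 0
  eqn : ∀ x ∈ O, ∀ i j, i ≠ j →
    ⁅aElem k i, pElem k (Matrix.of fun a b => pd (fun y => ξ y a b) j x)⁆
      - ⁅aElem k j, pElem k (Matrix.of fun a b => pd (fun y => ξ y a b) i x)⁆
      - ⁅⁅aElem k i, pElem k (ξ x)⁆, ⁅aElem k j, pElem k (ξ x)⁆⁆ = 0

/-- The coefficient of `dxᵢ` in the Lax pair `θ_λ = ∑ᵢ (λ aᵢ + [aᵢ, v]) dxᵢ`. -/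
def laxCoeff {n : ℕ} (k : ℕ) (ξ : Matrix (Fin n) (Fin (n + 1)) ℝ) (i : Fin n) (lam : ℂ) :
    Matrix (Idx n) (Idx n) ℂ :=
  lam • (aElem k i).map Complex.ofReal + (⁅aElem k i, pElem k ξ⁆).map Complex.ofReal

/-- `ρ = I_{n+1,n}`; the involution is `σ(g) = ρ g ρ⁻¹ = ρ g ρ`. -/
def rhoMat (n : ℕ) : Matrix (Idx n) (Idx n) ℂ := Matrix.fromBlocks 1 0 0 (-1)

/-- The Gram matrix `diag(I_{n+1}, J)` of the complex bilinear form on `ℂ^{2n+1}`. -/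
def gramMat (n k : ℕ) : Matrix (Idx n) (Idx n) ℂ :=
  Matrix.fromBlocks 1 0 0 ((matJ n k).map Complex.ofReal)

/-- `E = E(x, λ)` is an extended frame of `ξ` on `O`: a parallel frame `E⁻¹ dE = θ_λ` with values in
the complex orthogonal group of `gramMat`, holomorphic in `λ`, satisfying the reality condition. -/
structure IsExtendedFrame {n : ℕ} (k : ℕ) (O : Set (Euc n))
    (ξ : Euc n → Matrix (Fin n) (Fin (n + 1)) ℝ)
    (E : Euc n → ℂ → Matrix (Idx n) (Idx n) ℂ) : Prop where
  smooth : ∀ a b, ContDiffOn ℝ ∞ (fun p : Euc n × ℂ => E p.1 p.2 a b) (O ×ˢ Set.univ)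
  holomorphic : ∀ x ∈ O, ∀ a b, Differentiable ℂ (fun lam => E x lam a b)
  mem_group : ∀ x ∈ O, ∀ lam, (E x lam)ᵀ * gramMat n k * E x lam = gramMat n k
  parallel : ∀ x ∈ O, ∀ lam i a b,
    pd (fun y => E y lam a b) i x = (E x lam * laxCoeff k (ξ x) i lam) a b
  real : ∀ x ∈ O, ∀ lam, (E x (starRingEnd ℂ lam)).map (starRingEnd ℂ) = E x lam
  twisted : ∀ x ∈ O, ∀ lam, rhoMat n * E x (-lam) * rhoMat n = E x lam

/-- The upper right `(n+1) × n` block `Y` of `(∂E/∂λ) E⁻¹` at `λ = 0`. -/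
def frameY {n : ℕ} (E : Euc n → ℂ → Matrix (Idx n) (Idx n) ℂ) (x : Euc n) :
    Matrix (Fin (n + 1)) (Fin n) ℂ :=
  ((Matrix.of fun a b => deriv (fun lam => E x lam a b) 0) * (E x 0)⁻¹).toBlocks₁₂

/-- A basis of `ℝ^{n-k,k}` consisting of null vectors. -/
def IsNullBasis {n : ℕ} (k : ℕ) (c : Fin n → Fin n → ℝ) : Prop :=
  LinearIndependent ℝ c ∧ ∀ l, ∑ i, sgnK k i * c l i ^ 2 = 0

/-! ### Simple elements and Ribaucour transforms -/

/-- The complex bilinear form of signature `(2n+1-k, k)`. -/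
def pairing {n : ℕ} (k : ℕ) (v w : Idx n → ℂ) : ℂ := v ⬝ᵥ (gramMat n k *ᵥ w)

/-- `ρL ≠ L` for `L = ℂ v`. -/
def NotRhoInvariant {n : ℕ} (v : Idx n → ℂ) : Prop :=
  Submodule.span ℂ {rhoMat n *ᵥ v} ≠ Submodule.span ℂ {v}

/-- `v` spans an isotropic line `ℓ`, with `ρL ≠ L` for `L = ℂ v`, such that either
`ℓ ≤ ℝ^{2n+1-k,k}` and `α ∈ ℝ \ {0}`, or `ℓ ≤ ℝ^{n+1} ⊕ iℝ^{n-k,k}` and `α ∈ iℝ \ {0}`. -/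
structure IsAdmissible {n : ℕ} (k : ℕ) (α : ℂ) (v : Idx n → ℂ) : Prop where
  α_ne : α ≠ 0
  v_ne : v ≠ 0
  isotropic : pairing k v v = 0
  real : (α.im = 0 ∧ (∀ a, (v (Sum.inl a)).im = 0) ∧ ∀ b, (v (Sum.inr b)).im = 0) ∨
    (α.re = 0 ∧ (∀ a, (v (Sum.inl a)).im = 0) ∧ ∀ b, (v (Sum.inr b)).re = 0)
  notRho : NotRhoInvariant v

/-- The projection `π_L` onto `L = ℂ v` with kernel `(ρL)^⊥`: `x ↦ (x, ρv) / (v, ρv) • v`.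
It depends only on the line `L`. -/
def lineProj {n : ℕ} (k : ℕ) (v : Idx n → ℂ) : Matrix (Idx n) (Idx n) ℂ :=
  (pairing k v (rhoMat n *ᵥ v))⁻¹ • Matrix.vecMulVec v (gramMat n k *ᵥ (rhoMat n *ᵥ v))

/-- The simple element
`p_{α,L}(λ) = (λ-α)/(λ+α) π_L + π_{(L ⊕ ρL)^⊥} + (λ+α)/(λ-α) π_{ρL}`, where `L = ℂ v`. -/
def simpleElement {n : ℕ} (k : ℕ) (α : ℂ) (v : Idx n → ℂ) (lam : ℂ) :
    Matrix (Idx n) (Idx n) ℂ :=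
  ((lam - α) / (lam + α)) • lineProj k v
    + (1 - lineProj k v - lineProj k (rhoMat n *ᵥ v))
    + ((lam + α) / (lam - α)) • lineProj k (rhoMat n *ᵥ v)

/-- A spanning vector `E_α(x)⁻¹ v` of the line `L̃(x) = E_α(x)⁻¹ L`, where `L = ℂ v`. -/
def movedLine {n : ℕ} (α : ℂ) (v : Idx n → ℂ) (E : Euc n → ℂ → Matrix (Idx n) (Idx n) ℂ)
    (x : Euc n) : Idx n → ℂ := (E x α)⁻¹ *ᵥ v

/-- The dressed frame `Ẽ(x, λ) = E(x, λ) p_{α, L̃(x)}(λ)⁻¹`. -/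
def dressedFrame {n : ℕ} (k : ℕ) (α : ℂ) (v : Idx n → ℂ)
    (E : Euc n → ℂ → Matrix (Idx n) (Idx n) ℂ) (x : Euc n) (lam : ℂ) :
    Matrix (Idx n) (Idx n) ℂ :=
  E x lam * (simpleElement k α (movedLine α v E x) lam)⁻¹

/-- `(ξ, E, c)` generates the sequence `f` with initial frame `h`: `E` is the extended frame of the
solution `ξ` with `E(0, λ) = diag(h, I)`, `c` is a null basis and `f_l = f_l(0) + Y c_l`.
(For `h = I` the frame `E` is the normalised one.) -/
structure Generates {n : ℕ} (k : ℕ) (h : Matrix.orthogonalGroup (Fin (n + 1)) ℝ) (f : HSeq n)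
    (ξ : Euc n → Matrix (Fin n) (Fin (n + 1)) ℝ)
    (E : Euc n → ℂ → Matrix (Idx n) (Idx n) ℂ) (c : Fin n → Fin n → ℝ) : Prop where
  solution : IsSolution k f.domain ξ
  frame : IsExtendedFrame k f.domain ξ E
  initial : ∀ lam, E 0 lam =
    Matrix.fromBlocks ((h : Matrix (Fin (n + 1)) (Fin (n + 1)) ℝ).map Complex.ofReal) 0 0 1
  nullBasis : IsNullBasis k c
  eq_map : ∀ l, ∀ x ∈ f.domain, ∀ a, (f.map l x a : ℂ) =
    (f.map l 0 a : ℂ) + (frameY E x *ᵥ fun j => (c l j : ℂ)) a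

/-- The Ribaucour transform `R_{α,L}`, `L = ℂ v`, with respect to the initial frame `h`, as a
partially defined transformation of Combescure sequences: the set of all Combescure sequences `g`,
over simply connected open subsets of the domain of `f` on which `ρL̃(x) ≠ L̃(x)`, that are given
by `g_l = f_l(0) + Ỹ c_l`, with `Ỹ` read off from the dressed frame. -/
def ribaucour {n : ℕ} (k : ℕ) (α : ℂ) (v : Idx n → ℂ)
    (h : Matrix.orthogonalGroup (Fin (n + 1)) ℝ) (f : HSeq n) : Set (HSeq n) :=
  {g | IsCombescure k g ∧ g.domain ⊆ f.domain ∧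
    ∃ ξ E c, Generates k h f ξ E c ∧
      ∀ x ∈ g.domain, NotRhoInvariant (movedLine α v E x) ∧
        ∀ l a, (g.map l x a : ℂ) =
          (f.map l 0 a : ℂ) + (frameY (dressedFrame k α v E) x *ᵥ fun j => (c l j : ℂ)) a}

end

/-!
The Lie transform lifts to frames: if `E` is an extended frame of `ξ`, then `E(r⁻¹x, rλ)` is an
extended frame of `r⁻¹ξ(r⁻¹x)` with the same initial value, and its `Y` is `r Y_E(r⁻¹x)`, so it
generates `S_r f` with the same null basis. The simple element `p_{r⁻¹α,L}(λ)` equals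
`p_{α,L}(rλ)`, so this rescaling commutes with dressing (`dressedFrame_scaledFrame`). Hence `S_r`
maps values of `R_{α,L}` at `f` to values of `R_{r⁻¹α,L}` at `S_r f`
(`lieTransform_mem_ribaucour`). Applying this to `r` and to `r⁻¹` gives both inclusions of the
asserted equality.

The transform is single valued because `f` and the initial frame determine the pair `(E, c)`.
Differentiating `E⁻¹ dE = θ_λ` in `λ` gives `∂Y/∂xᵢ = (E aᵢ E⁻¹)₁₂` at `λ = 0`
(`IsExtendedFrame.hasMatPd_frameY`). With `E(x, 0) = diag(A, B)` this is, up to a constant sign,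
the rank one matrix formed by column `i` of `A` and row `i` of `B⁻¹`. At `x = 0` the frame is
prescribed, so the derivatives of `f_l` there give `c_l` (`Generates.basis_unique`). Now `Y` is
determined, hence so are these columns and rows up to signs; the signs are locally constant and
equal `1` at `0`, so `E(x, 0)` is determined on the connected domain
(`IsExtendedFrame.eq_at_zero`). As `E(x, 0)⁻¹ dE(x, 0) = ∑ [aᵢ, v] dxᵢ`, the whole Lax pair is
determined, and with it `E` (`IsExtendedFrame.eq_of_eq_at_zero`).
-/

/-! ### Scaling of the parameter domain and of the spectral parameter -/

section Scaling

variable {n : ℕ} {V : Type*} [NormedAddCommGroup V] [NormedSpace ℝ V]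

theorem pd_comp_smul (f : Euc n → V) (s : ℝ) (i : Fin n) (x : Euc n) :
    pd (fun y => f (s • y)) i x = s • pd f i (s • x) := by
  have := fderiv_comp_smul (𝕜 := ℝ) (f := f) (x := x) s
  simp only [pd]
  rw [this]; rfl

theorem pd_const_smul {R : Type*} [DivisionRing R] [Module R V] [SMulCommClass ℝ R V]
    [ContinuousConstSMul R V] (f : Euc n → V) (s : R) (i : Fin n) (x : Euc n) :
    pd (fun y => s • f y) i x = s • pd f i x := by
  have : fderiv ℝ (fun y => s • f y) x = s • fderiv ℝ f x := by
    simpa using! congrFun (fderiv_const_smul_field (𝕜 := ℝ) (f := f) s) x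
  simp only [pd]
  rw [this]; rfl

theorem pd_congr_of_isOpen {O : Set (Euc n)} (hO : IsOpen O) {f g : Euc n → V}
    (h : ∀ x ∈ O, f x = g x) {x : Euc n} (hx : x ∈ O) (i : Fin n) : pd f i x = pd g i x := by
  have : f =ᶠ[nhds x] g := Filter.eventuallyEq_of_mem (hO.mem_nhds hx) h
  simp only [pd, this.fderiv_eq]

theorem contDiffOn_comp_smul {O : Set (Euc n)} {f : Euc n → V} (h : ContDiffOn ℝ ∞ f O) (s : ℝ) :
    ContDiffOn ℝ ∞ (fun x => f (s • x)) {x | s • x ∈ O} :=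
  h.comp (contDiff_const_smul s).contDiffOn fun _ hx => hx

theorem pd_lieTransform {r : ℝ} (hr : r ≠ 0) (f : HSeq n) (l i : Fin n) :
    pd ((lieTransform r f).map l) i = fun x => pd (f.map l) i (r⁻¹ • x) := by
  funext x
  have h := pd_comp_smul (fun y => r • f.map l y) r⁻¹ i x
  rwa [pd_const_smul (f.map l), inv_smul_smul₀ hr] at h

theorem simplyConnectedSpace_preimage_smul {O : Set (Euc n)} (h : SimplyConnectedSpace O) {s : ℝ}
    (hs : s ≠ 0) : SimplyConnectedSpace {x : Euc n | s • x ∈ O} := by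
  let e : {x : Euc n | s • x ∈ O} ≃ₜ O :=
    (Homeomorph.smulOfNeZero s hs).subtype fun x => by simp
  exact e.toHomotopyEquiv.simplyConnectedSpace

/-- First derivatives are unchanged under the Lie transform, and second derivatives are scaled, so
all conditions on a Combescure sequence transfer pointwise from `r⁻¹ • x` to `x`. -/
theorem IsCombescure.lieTransform {k : ℕ} {f : HSeq n} (hf : IsCombescure k f) {r : ℝ}
    (hr : r ≠ 0) : IsCombescure k (lieTransform r f) where
  isOpen := hf.isOpen.preimage (continuous_const_smul r⁻¹)
  simplyConnected := simplyConnectedSpace_preimage_smul hf.simplyConnected (inv_ne_zero hr)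
  isothermic l :=
    { smooth := (contDiffOn_comp_smul (hf.isothermic l).smooth r⁻¹).const_smul r
      immersion := fun x hx => by
        simpa only [pd_lieTransform hr] using (hf.isothermic l).immersion _ hx
      orthogonal := fun x hx => by
        simpa only [pd_lieTransform hr] using (hf.isothermic l).orthogonal _ hx
      curvature := fun x hx ν hν i j hij => by
        simp only [pd_lieTransform hr] at hν ⊢
        rw [pd_comp_smul, real_inner_smul_left, (hf.isothermic l).curvature _ hx ν hν i j hij,
          mul_zero]
      guichard := fun x hx => by
        simpa only [pd_lieTransform hr] using (hf.isothermic l).guichard _ hx }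
  combescure l m hlm x hx := by
    simpa only [pd_lieTransform hr] using hf.combescure l m hlm _ hx
  independent := by
    obtain ⟨u, hu, hpar, hind⟩ := hf.independent
    refine ⟨fun l x => u l (r⁻¹ • x), fun l => ⟨contDiffOn_comp_smul (hu l).smooth r⁻¹, ?_⟩, ?_,
      fun x hx => hind _ hx⟩
    · intro x hx
      simpa only [pd_lieTransform hr] using (hu l).sq_eq _ hx
    · intro x hx
      simpa only [pd_lieTransform hr] using hpar _ hx

theorem lieTransform_lieTransform_inv {r : ℝ} (hr : r ≠ 0) (f : HSeq n) :
    lieTransform r (lieTransform r⁻¹ f) = f := by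
  ext1 <;> simp [lieTransform, smul_smul, hr]

theorem IsAdmissible.real_mul {k : ℕ} {α : ℂ} {v : Idx n → ℂ} (hv : IsAdmissible k α v) {s : ℝ}
    (hs : s ≠ 0) : IsAdmissible k ((s : ℂ) * α) v where
  α_ne := mul_ne_zero (Complex.ofReal_ne_zero.2 hs) hv.α_ne
  v_ne := hv.v_ne
  isotropic := hv.isotropic
  real := by
    rcases hv.real with ⟨h, h'⟩ | ⟨h, h'⟩
    · exact Or.inl ⟨by simp [h], h'⟩
    · exact Or.inr ⟨by simp [h], h'⟩
  notRho := hv.notRho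

theorem matrix_lie_smul {ι : Type*} [Fintype ι] (s : ℝ) (A B : Matrix ι ι ℝ) :
    ⁅A, s • B⁆ = s • ⁅A, B⁆ := by
  simp [Ring.lie_def, smul_sub]

theorem matrix_smul_lie {ι : Type*} [Fintype ι] (s : ℝ) (A B : Matrix ι ι ℝ) :
    ⁅s • A, B⁆ = s • ⁅A, B⁆ := by
  simp [Ring.lie_def, smul_sub]

theorem pElem_smul (k : ℕ) (s : ℝ) (ξ : Matrix (Fin n) (Fin (n + 1)) ℝ) :
    pElem k (s • ξ) = s • pElem k ξ := by
  simp [pElem, Matrix.fromBlocks_smul]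

/-- The rescaled frame `E(r⁻¹ x, r λ)`. -/
noncomputable def scaledFrame (r : ℝ) (E : Euc n → ℂ → Matrix (Idx n) (Idx n) ℂ) :
    Euc n → ℂ → Matrix (Idx n) (Idx n) ℂ :=
  fun x lam => E (r⁻¹ • x) (r * lam)

theorem IsSolution.scaled {k : ℕ} {O : Set (Euc n)} {ξ : Euc n → Matrix (Fin n) (Fin (n + 1)) ℝ}
    (h : IsSolution k O ξ) (s : ℝ) :
    IsSolution k {x | s • x ∈ O} fun x => s • ξ (s • x) where
  smooth a b := (contDiffOn_comp_smul (h.smooth a b) s).const_smul s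
  diag x hx i := by simp [h.diag _ hx i]
  eqn x hx i j hij := by
    have hpd : ∀ m, (Matrix.of fun a b => pd (fun y => (s • ξ (s • y)) a b) m x) =
        (s * s) • Matrix.of fun a b => pd (fun y => ξ y a b) m (s • x) := by
      intro m
      ext a b
      have h1 := pd_const_smul (fun y => ξ (s • y) a b) s m x
      rw [pd_comp_smul (fun y => ξ y a b)] at h1
      simpa [mul_assoc] using! h1
    have := congrArg (fun M => (s * s) • M) (h.eqn _ hx i j hij)
    simp only [hpd, pElem_smul, matrix_lie_smul, matrix_smul_lie, smul_smul]
    simpa [smul_sub] using this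

theorem IsExtendedFrame.scaled {k : ℕ} {O : Set (Euc n)}
    {ξ : Euc n → Matrix (Fin n) (Fin (n + 1)) ℝ} {E : Euc n → ℂ → Matrix (Idx n) (Idx n) ℂ}
    (h : IsExtendedFrame k O ξ E) {r : ℝ} (hr : r ≠ 0) :
    IsExtendedFrame k {x | r⁻¹ • x ∈ O} (fun x => r⁻¹ • ξ (r⁻¹ • x)) (scaledFrame r E) where
  smooth a b := by
    refine (h.smooth a b).comp (g := fun p : Euc n × ℂ => E p.1 p.2 a b)
      (f := fun p : Euc n × ℂ => (r⁻¹ • p.1, (r : ℂ) * p.2)) ?_ fun p hp => ⟨hp.1, trivial⟩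
    exact ((contDiff_fst.const_smul r⁻¹).prodMk (contDiff_const.mul contDiff_snd)).contDiffOn
  holomorphic x hx a b :=
    (h.holomorphic _ hx a b).comp (differentiable_id.const_mul (r : ℂ))
  mem_group x hx lam := h.mem_group _ hx _
  parallel x hx lam i a b := by
    have hθ : laxCoeff k (r⁻¹ • ξ (r⁻¹ • x)) i lam =
        (r⁻¹ : ℂ) • laxCoeff k (ξ (r⁻¹ • x)) i (r * lam) := by
      have hr' : (r : ℂ) ≠ 0 := Complex.ofReal_ne_zero.2 hr
      simp only [laxCoeff, pElem_smul, matrix_lie_smul, smul_add, smul_smul]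
      rw [inv_mul_cancel_left₀ hr']
      congr 1
      ext a b
      simp
    have h1 := pd_comp_smul (fun y => E y (r * lam) a b) r⁻¹ i x
    rw [h.parallel _ hx] at h1
    rw [hθ, Matrix.mul_smul]
    simpa [scaledFrame] using h1
  real x hx lam := by simpa [scaledFrame] using h.real _ hx (r * lam)
  twisted x hx lam := by simpa [scaledFrame] using h.twisted _ hx (r * lam)

theorem frameY_scaledFrame (r : ℝ) (E : Euc n → ℂ → Matrix (Idx n) (Idx n) ℂ) (x : Euc n) :
    frameY (scaledFrame r E) x = (r : ℂ) • frameY E (r⁻¹ • x) := by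
  have : (Matrix.of fun a b => deriv (fun lam => scaledFrame r E x lam a b) 0) =
      (r : ℂ) • Matrix.of fun a b => deriv (fun lam => E (r⁻¹ • x) lam a b) 0 := by
    ext a b
    simpa [scaledFrame] using
      deriv_comp_mul_left (r : ℂ) (fun lam => E (r⁻¹ • x) lam a b) 0
  unfold frameY
  rw [this, Matrix.smul_mul]
  ext a b
  simp [Matrix.toBlocks₁₂, scaledFrame]

theorem simpleElement_scaled (k : ℕ) {r : ℂ} (hr : r ≠ 0) (α : ℂ) (v : Idx n → ℂ) (lam : ℂ) :
    simpleElement k (r⁻¹ * α) v lam = simpleElement k α v (r * lam) := by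
  have h1 : (lam - r⁻¹ * α) / (lam + r⁻¹ * α) = (r * lam - α) / (r * lam + α) := by
    rw [← mul_div_mul_left _ _ hr, mul_sub, mul_add, mul_inv_cancel_left₀ hr]
  have h2 : (lam + r⁻¹ * α) / (lam - r⁻¹ * α) = (r * lam + α) / (r * lam - α) := by
    rw [← mul_div_mul_left _ _ hr, mul_sub, mul_add, mul_inv_cancel_left₀ hr]
  rw [simpleElement, simpleElement, h1, h2]

theorem movedLine_scaledFrame {r : ℝ} (hr : r ≠ 0) (α : ℂ) (v : Idx n → ℂ)
    (E : Euc n → ℂ → Matrix (Idx n) (Idx n) ℂ) (x : Euc n) :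
    movedLine ((r : ℂ)⁻¹ * α) v (scaledFrame r E) x = movedLine α v E (r⁻¹ • x) := by
  simp [movedLine, scaledFrame, hr]

theorem dressedFrame_scaledFrame (k : ℕ) {r : ℝ} (hr : r ≠ 0) (α : ℂ) (v : Idx n → ℂ)
    (E : Euc n → ℂ → Matrix (Idx n) (Idx n) ℂ) :
    dressedFrame k ((r : ℂ)⁻¹ * α) v (scaledFrame r E) = scaledFrame r (dressedFrame k α v E) := by
  funext x lam
  rw [dressedFrame, movedLine_scaledFrame hr,
    simpleElement_scaled k (Complex.ofReal_ne_zero.2 hr)]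
  rfl

theorem Generates.scaled {k : ℕ} {h : Matrix.orthogonalGroup (Fin (n + 1)) ℝ} {f : HSeq n}
    {ξ : Euc n → Matrix (Fin n) (Fin (n + 1)) ℝ} {E : Euc n → ℂ → Matrix (Idx n) (Idx n) ℂ}
    {c : Fin n → Fin n → ℝ} (hg : Generates k h f ξ E c) {r : ℝ} (hr : r ≠ 0) :
    Generates k h (lieTransform r f) (fun x => r⁻¹ • ξ (r⁻¹ • x)) (scaledFrame r E) c where
  solution := hg.solution.scaled r⁻¹
  frame := hg.frame.scaled hr
  initial lam := by simpa [scaledFrame] using hg.initial (r * lam)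
  nullBasis := hg.nullBasis
  eq_map l x hx a := by
    have := hg.eq_map l _ hx a
    simp [frameY_scaledFrame, lieTransform, Matrix.smul_mulVec, this, mul_add]

theorem lieTransform_mem_ribaucour {k : ℕ} {α : ℂ} {v : Idx n → ℂ}
    {h : Matrix.orthogonalGroup (Fin (n + 1)) ℝ} {f g : HSeq n} (hg : g ∈ ribaucour k α v h f)
    {r : ℝ} (hr : r ≠ 0) :
    lieTransform r g ∈ ribaucour k ((r : ℂ)⁻¹ * α) v h (lieTransform r f) := by
  obtain ⟨hC, hdom, ξ, E, c, hgen, hval⟩ := hg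
  refine ⟨hC.lieTransform hr, fun x hx => hdom hx, _, _, c, hgen.scaled hr, fun x hx => ?_⟩
  obtain ⟨hnot, hmap⟩ := hval _ hx
  rw [movedLine_scaledFrame hr, dressedFrame_scaledFrame k hr, frameY_scaledFrame]
  refine ⟨hnot, fun l a => ?_⟩
  simp [lieTransform, Matrix.smul_mulVec, hmap, mul_add]

theorem lieTransform_image_ribaucour {k : ℕ} {α : ℂ} {v : Idx n → ℂ}
    {h : Matrix.orthogonalGroup (Fin (n + 1)) ℝ} {f : HSeq n} {r : ℝ} (hr : r ≠ 0) :
    lieTransform r '' ribaucour k α v h (lieTransform r⁻¹ f) =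
      ribaucour k ((r : ℂ)⁻¹ * α) v h f := by
  apply Set.Subset.antisymm
  · rintro _ ⟨g, hg, rfl⟩
    simpa only [lieTransform_lieTransform_inv hr] using lieTransform_mem_ribaucour hg hr
  · intro g hg
    refine ⟨lieTransform r⁻¹ g, ?_, lieTransform_lieTransform_inv hr g⟩
    have := lieTransform_mem_ribaucour hg (inv_ne_zero hr)
    rwa [Complex.ofReal_inv, inv_inv, mul_inv_cancel_left₀ (Complex.ofReal_ne_zero.2 hr)] at this

end Scaling

/-! ### Partial derivatives of matrix-valued functions -/

section MatrixPartialDerivative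

variable {n : ℕ} {ι κ μ : Type*}

/-- The matrix-valued function `M` is differentiable at `x`, entry by entry, with `∂M/∂xᵢ = N`.
Working with entries avoids the choice of a norm on matrices. -/
def HasMatPd (M : Euc n → Matrix ι κ ℂ) (N : Matrix ι κ ℂ) (i : Fin n) (x : Euc n) : Prop :=
  ∀ a b, DifferentiableAt ℝ (fun y => M y a b) x ∧ pd (fun y => M y a b) i x = N a b

theorem hasMatPd_const (M : Matrix ι κ ℂ) (i : Fin n) (x : Euc n) :
    HasMatPd (fun _ => M) 0 i x :=
  fun a b => ⟨differentiableAt_const _, by simp [pd]⟩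

theorem HasMatPd.transpose {M : Euc n → Matrix ι κ ℂ} {N : Matrix ι κ ℂ} {i : Fin n} {x : Euc n}
    (h : HasMatPd M N i x) : HasMatPd (fun y => (M y)ᵀ) Nᵀ i x :=
  fun a b => h b a

theorem HasMatPd.toBlocks₁₂ {ι' κ' : Type*} {M : Euc n → Matrix (ι ⊕ ι') (κ ⊕ κ') ℂ}
    {N : Matrix (ι ⊕ ι') (κ ⊕ κ') ℂ} {i : Fin n} {x : Euc n} (h : HasMatPd M N i x) :
    HasMatPd (fun y => (M y).toBlocks₁₂) N.toBlocks₁₂ i x :=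
  fun a b => h (Sum.inl a) (Sum.inr b)

theorem HasMatPd.mul [Fintype κ] {M : Euc n → Matrix ι κ ℂ} {M' : Matrix ι κ ℂ}
    {N : Euc n → Matrix κ μ ℂ} {N' : Matrix κ μ ℂ} {i : Fin n} {x : Euc n}
    (hM : HasMatPd M M' i x) (hN : HasMatPd N N' i x) :
    HasMatPd (fun y => M y * N y) (M' * N x + M x * N') i x := by
  intro a b
  have hd : ∀ k ∈ Finset.univ, DifferentiableAt ℝ (fun y => M y a k * N y k b) x :=
    fun k _ => (hM a k).1.fun_mul (hN k b).1
  simp only [Matrix.mul_apply, Matrix.add_apply]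
  refine ⟨DifferentiableAt.fun_sum hd, ?_⟩
  rw [pd, fderiv_fun_sum hd, sum_apply, ← Finset.sum_add_distrib]
  refine Finset.sum_congr rfl fun k _ => ?_
  have h1 := (hM a k).2
  have h2 := (hN k b).2
  rw [pd] at h1 h2
  rw [fderiv_fun_mul (hM a k).1 (hN k b).1]
  simp [h1, h2]
  ring

theorem HasMatPd.congr {O : Set (Euc n)} (hO : IsOpen O) {M M' : Euc n → Matrix ι κ ℂ}
    {N : Matrix ι κ ℂ} {i : Fin n} {x : Euc n} (hx : x ∈ O) (h : HasMatPd M N i x)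
    (hMM' : ∀ y ∈ O, M' y = M y) : HasMatPd M' N i x := by
  intro a b
  have hab : ∀ y ∈ O, M' y a b = M y a b := fun y hy => by rw [hMM' y hy]
  exact ⟨(h a b).1.congr_of_eventuallyEq (Filter.eventuallyEq_of_mem (hO.mem_nhds hx) hab),
    (pd_congr_of_isOpen hO hab hx i).trans (h a b).2⟩

theorem HasMatPd.unique {M : Euc n → Matrix ι κ ℂ} {N N' : Matrix ι κ ℂ} {i : Fin n} {x : Euc n}
    (h : HasMatPd M N i x) (h' : HasMatPd M N' i x) : N = N' := by
  ext a b
  rw [← (h a b).2, ← (h' a b).2]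

theorem HasMatPd.eq_of_eqOn {O : Set (Euc n)} (hO : IsOpen O) {M M' : Euc n → Matrix ι κ ℂ}
    {N N' : Matrix ι κ ℂ} {i : Fin n} {x : Euc n} (hx : x ∈ O) (h : HasMatPd M N i x)
    (h' : HasMatPd M' N' i x) (hMM' : ∀ y ∈ O, M y = M' y) : N = N' :=
  h.unique (h'.congr hO hx hMM')

theorem fderiv_eq_zero_of_pd {φ : Euc n → ℂ} {x : Euc n} (h : ∀ i, pd φ i x = 0) :
    fderiv ℝ φ x = 0 := by
  apply ContinuousLinearMap.coe_injective
  refine (EuclideanSpace.basisFun (Fin n) ℝ).toBasis.ext fun i => ?_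
  simpa [pd] using h i

theorem eq_of_hasMatPd_zero {O : Set (Euc n)} (hO : IsOpen O) (hc : IsPreconnected O)
    {M : Euc n → Matrix ι κ ℂ} {x₀ : Euc n} (h : ∀ x ∈ O, ∀ i, HasMatPd M 0 i x)
    (hx₀ : x₀ ∈ O) {x : Euc n} (hx : x ∈ O) : M x = M x₀ := by
  rcases isEmpty_or_nonempty (Fin n) with _ | ⟨⟨i₀⟩⟩
  · rw [Subsingleton.elim x x₀]
  ext a b
  exact hO.is_const_of_fderiv_eq_zero (𝕜 := ℝ) (f := fun y => M y a b) hc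
    (fun y hy => (h y hy i₀ a b).1.differentiableWithinAt)
    (fun y hy => fderiv_eq_zero_of_pd fun i => (h y hy i a b).2) hx hx₀

end MatrixPartialDerivative

section MixedPartial

variable {n : ℕ}

/-- Mixed partial derivatives commute: `∂_{xᵢ} ∂_λ F = ∂_λ ∂_{xᵢ} F` at `λ = 0`, where `G` is the
function `λ ↦ ∂F/∂xᵢ (x, λ)`. -/
theorem pd_deriv_eq {O : Set (Euc n)} (hO : IsOpen O) {F : Euc n × ℂ → ℂ}
    (hF : ContDiffOn ℝ ∞ F (O ×ˢ Set.univ))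
    (hhol : ∀ x ∈ O, Differentiable ℂ fun lam => F (x, lam)) {x : Euc n} (hx : x ∈ O) {i : Fin n}
    {G : ℂ → ℂ} {G' : ℂ} (hG : ∀ lam, pd (fun y => F (y, lam)) i x = G lam)
    (hG' : HasDerivAt G G' 0) :
    DifferentiableAt ℝ (fun y => deriv (fun lam => F (y, lam)) 0) x ∧
      pd (fun y => deriv (fun lam => F (y, lam)) 0) i x = G' := by
  have hU : IsOpen (O ×ˢ (Set.univ : Set ℂ)) := hO.prod isOpen_univ
  have hFat : ∀ y ∈ O, ∀ lam : ℂ, ContDiffAt ℝ ∞ F (y, lam) := fun y hy lam =>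
    hF.contDiffAt (hU.mem_nhds ⟨hy, trivial⟩)
  have hFd : ∀ y ∈ O, ∀ lam : ℂ, HasFDerivAt F (fderiv ℝ F (y, lam)) (y, lam) := fun y hy lam =>
    ((hFat y hy lam).differentiableAt (by simp)).hasFDerivAt
  have hlam : ∀ y ∈ O, deriv (fun lam => F (y, lam)) 0 = fderiv ℝ F (y, 0) (0, 1) := by
    intro y hy
    have h1 : HasFDerivAt (fun lam => F (y, lam))
        ((fderiv ℝ F (y, 0)).comp (ContinuousLinearMap.inr ℝ (Euc n) ℂ)) (0 : ℂ) :=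
      (hFd y hy 0).comp (0 : ℂ) (hasFDerivAt_prodMk_right y 0)
    have h2 := (hhol y hy 0).hasDerivAt.hasFDerivAt.restrictScalars ℝ
    have h3 := congrArg (fun T : ℂ →L[ℝ] ℂ => T 1) (h2.unique h1)
    simpa using h3
  have hpd : ∀ lam, fderiv ℝ F (x, lam) (EuclideanSpace.single i 1, 0) = G lam := by
    intro lam
    have h1 : HasFDerivAt (fun y => F (y, lam))
        ((fderiv ℝ F (x, lam)).comp (ContinuousLinearMap.inl ℝ (Euc n) ℂ)) x :=
      (hFd x hx lam).comp x (hasFDerivAt_prodMk_left x lam)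
    rw [← hG lam, pd, h1.fderiv]
    simp
  have hD : HasFDerivAt (fderiv ℝ F) (fderiv ℝ (fderiv ℝ F) (x, 0)) (x, 0) :=
    (((hFat x hx 0).fderiv_right (m := 1) (by norm_cast)).differentiableAt (by simp)).hasFDerivAt
  have hsymm : IsSymmSndFDerivAt ℝ F (x, 0) :=
    (hFat x hx 0).isSymmSndFDerivAt (by simpa using WithTop.coe_le_coe.2 (le_top : (2 : ℕ∞) ≤ ⊤))
  have hx1 : HasFDerivAt (fun y => fderiv ℝ F (y, 0) (0, 1))
      (((ContinuousLinearMap.apply ℝ ℂ ((0 : Euc n), (1 : ℂ))).comp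
        (fderiv ℝ (fderiv ℝ F) (x, 0))).comp (ContinuousLinearMap.inl ℝ (Euc n) ℂ)) x :=
    (ContinuousLinearMap.apply ℝ ℂ ((0 : Euc n), (1 : ℂ))).hasFDerivAt.comp x
      (HasFDerivAt.comp (f := fun y : Euc n => (y, (0 : ℂ))) x hD (hasFDerivAt_prodMk_left x 0))
  have hx2 : HasFDerivAt G
      (((ContinuousLinearMap.apply ℝ ℂ ((EuclideanSpace.single i 1 : Euc n), (0 : ℂ))).comp
        (fderiv ℝ (fderiv ℝ F) (x, 0))).comp (ContinuousLinearMap.inr ℝ (Euc n) ℂ)) (0 : ℂ) := by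
    rw [← funext hpd]
    exact (ContinuousLinearMap.apply ℝ ℂ
      ((EuclideanSpace.single i 1 : Euc n), (0 : ℂ))).hasFDerivAt.comp (0 : ℂ)
        (HasFDerivAt.comp (f := fun lam : ℂ => (x, lam)) (0 : ℂ) hD (hasFDerivAt_prodMk_right x 0))
  have hG1 := congrArg (fun T : ℂ →L[ℝ] ℂ => T 1)
    ((hG'.hasFDerivAt.restrictScalars ℝ).unique hx2)
  have hev := Filter.eventuallyEq_of_mem (hO.mem_nhds hx) hlam
  refine ⟨hx1.differentiableAt.congr_of_eventuallyEq hev, ?_⟩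
  rw [pd, hev.fderiv_eq, hx1.fderiv]
  have h4 := hsymm.eq (EuclideanSpace.single i 1, 0) (0, 1)
  simp at hG1 ⊢
  rw [hG1, h4]

end MixedPartial

/-! ### Extended frames and the derivative of `Y` -/

section ExtendedFrame

variable {n k : ℕ}

theorem sgnK_mul_self (k : ℕ) (i : Fin n) : sgnK k i * sgnK k i = 1 := by
  unfold sgnK; split_ifs <;> norm_num

theorem sgnK_ne_zero (k : ℕ) (i : Fin n) : sgnK k i ≠ 0 := by
  unfold sgnK; split_ifs <;> norm_num

theorem matJ_map_mul_self (n k : ℕ) :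
    (matJ n k).map Complex.ofReal * (matJ n k).map Complex.ofReal = 1 := by
  have : matJ n k * matJ n k = 1 := by
    simp [matJ, Matrix.diagonal_mul_diagonal, sgnK_mul_self]
  have h := congrArg (fun M => M.map Complex.ofRealHom) this
  simpa [Matrix.map_mul] using! h

theorem gramMat_mul_self (n k : ℕ) : gramMat n k * gramMat n k = 1 := by
  simp [gramMat, Matrix.fromBlocks_multiply, matJ_map_mul_self]

variable {O : Set (Euc n)} {ξ : Euc n → Matrix (Fin n) (Fin (n + 1)) ℝ}
  {E : Euc n → ℂ → Matrix (Idx n) (Idx n) ℂ} {x : Euc n}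

theorem IsExtendedFrame.left_inverse (hE : IsExtendedFrame k O ξ E) (hx : x ∈ O) (lam : ℂ) :
    (gramMat n k * (E x lam)ᵀ * gramMat n k) * E x lam = 1 := by
  rw [Matrix.mul_assoc, Matrix.mul_assoc, ← Matrix.mul_assoc (E x lam)ᵀ, hE.mem_group x hx,
    gramMat_mul_self]

theorem IsExtendedFrame.inv_eq (hE : IsExtendedFrame k O ξ E) (hx : x ∈ O) (lam : ℂ) :
    (E x lam)⁻¹ = gramMat n k * (E x lam)ᵀ * gramMat n k :=
  Matrix.inv_eq_left_inv (hE.left_inverse hx lam)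

theorem IsExtendedFrame.inv_mul (hE : IsExtendedFrame k O ξ E) (hx : x ∈ O) (lam : ℂ) :
    (E x lam)⁻¹ * E x lam = 1 := by
  rw [hE.inv_eq hx, hE.left_inverse hx]

theorem IsExtendedFrame.mul_inv (hE : IsExtendedFrame k O ξ E) (hx : x ∈ O) (lam : ℂ) :
    E x lam * (E x lam)⁻¹ = 1 :=
  mul_eq_one_comm.1 (hE.inv_mul hx lam)

theorem IsExtendedFrame.hasMatPd (hE : IsExtendedFrame k O ξ E) (hO : IsOpen O) (hx : x ∈ O)
    (lam : ℂ) (i : Fin n) :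
    HasMatPd (fun y => E y lam) (E x lam * laxCoeff k (ξ x) i lam) i x := by
  intro a b
  refine ⟨?_, hE.parallel x hx lam i a b⟩
  have h1 : DifferentiableAt ℝ (fun p : Euc n × ℂ => E p.1 p.2 a b) (x, lam) :=
    ((hE.smooth a b).contDiffAt ((hO.prod isOpen_univ).mem_nhds ⟨hx, trivial⟩)).differentiableAt
      (by simp)
  exact h1.comp (f := fun y : Euc n => (y, lam)) x
    (hasFDerivAt_prodMk_left x lam).differentiableAt

theorem IsExtendedFrame.hasMatPd_inv (hE : IsExtendedFrame k O ξ E) (hO : IsOpen O) (hx : x ∈ O)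
    (lam : ℂ) (i : Fin n) :
    HasMatPd (fun y => (E y lam)⁻¹) (-(laxCoeff k (ξ x) i lam * (E x lam)⁻¹)) i x := by
  have h1 := ((hasMatPd_const (gramMat n k) i x).mul (hE.hasMatPd hO hx lam i).transpose).mul
    (hasMatPd_const (gramMat n k) i x)
  obtain ⟨N, h2⟩ : ∃ N, HasMatPd (fun y => (E y lam)⁻¹) N i x :=
    ⟨_, h1.congr hO hx fun y hy => hE.inv_eq hy lam⟩
  -- The derivative of the inverse is found by differentiating `E⁻¹ E = 1`.
  have h3 := (h2.mul (hE.hasMatPd hO hx lam i)).eq_of_eqOn hO hx (hasMatPd_const 1 i x)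
    fun y hy => hE.inv_mul hy lam
  rw [← Matrix.mul_assoc, hE.inv_mul hx, Matrix.one_mul] at h3
  have h4 := congrArg (· * (E x lam)⁻¹) h3
  rw [Matrix.add_mul, Matrix.mul_assoc _ (E x lam), hE.mul_inv hx, Matrix.mul_one,
    Matrix.zero_mul] at h4
  rwa [eq_neg_of_add_eq_zero_left h4] at h2

theorem laxCoeff_eq_add (k : ℕ) (ξ : Matrix (Fin n) (Fin (n + 1)) ℝ) (i : Fin n) (lam : ℂ) :
    laxCoeff k ξ i lam = lam • (aElem k i).map Complex.ofReal + laxCoeff k ξ i 0 := by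
  simp [laxCoeff]

theorem IsExtendedFrame.hasMatPd_deriv (hE : IsExtendedFrame k O ξ E) (hO : IsOpen O)
    (hx : x ∈ O) (i : Fin n) :
    HasMatPd (fun y => Matrix.of fun a b => deriv (fun lam => E y lam a b) 0)
      ((Matrix.of fun a b => deriv (fun lam => E x lam a b) 0) * laxCoeff k (ξ x) i 0 +
        E x 0 * (aElem k i).map Complex.ofReal) i x := by
  intro a b
  refine pd_deriv_eq (F := fun p : Euc n × ℂ => E p.1 p.2 a b) hO (hE.smooth a b)
    (fun y hy => hE.holomorphic y hy a b) hx (fun lam => hE.parallel x hx lam i a b) ?_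
  simp only [Matrix.mul_apply, Matrix.add_apply, ← Finset.sum_add_distrib]
  refine HasDerivAt.fun_sum fun m _ => ?_
  have h1 : HasDerivAt (fun lam => laxCoeff k (ξ x) i lam m b)
      ((aElem k i).map Complex.ofReal m b) 0 := by
    have h := ((hasDerivAt_id (0 : ℂ)).mul_const ((aElem k i).map Complex.ofReal m b)).add_const
      (laxCoeff k (ξ x) i 0 m b)
    rw [one_mul] at h
    convert! h using 2 with lam
    rw [laxCoeff_eq_add]
    simp
  exact (hE.holomorphic x hx a m 0).hasDerivAt.fun_mul h1

/-- The Sym-type formula for the derivative of `Y`: the connection terms cancel, and only the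
coefficient of `λ` in the Lax pair survives. -/
theorem IsExtendedFrame.hasMatPd_frameY (hE : IsExtendedFrame k O ξ E) (hO : IsOpen O)
    (hx : x ∈ O) (i : Fin n) :
    HasMatPd (frameY E)
      (E x 0 * (aElem k i).map Complex.ofReal * (E x 0)⁻¹).toBlocks₁₂ i x := by
  have h := ((hE.hasMatPd_deriv hO hx i).mul (hE.hasMatPd_inv hO hx 0 i)).toBlocks₁₂
  simpa only [Matrix.add_mul, Matrix.mul_neg, Matrix.mul_assoc, add_neg_cancel_comm] using! h

theorem IsExtendedFrame.offDiag_eq_zero (hE : IsExtendedFrame k O ξ E) (hx : x ∈ O) :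
    (E x 0).toBlocks₁₂ = 0 ∧ (E x 0).toBlocks₂₁ = 0 := by
  have h := hE.twisted x hx 0
  rw [neg_zero, ← Matrix.fromBlocks_toBlocks (E x 0), rhoMat, Matrix.fromBlocks_multiply,
    Matrix.fromBlocks_multiply, Matrix.fromBlocks_inj] at h
  obtain ⟨-, h1, h2, -⟩ := h
  simp only [Matrix.one_mul, Matrix.zero_mul, Matrix.mul_neg, Matrix.mul_one, Matrix.mul_zero,
    Matrix.neg_mul, add_zero, zero_add] at h1 h2
  exact ⟨Matrix.ext fun a b => self_eq_neg.1 (congrFun₂ h1.symm a b),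
    Matrix.ext fun a b => self_eq_neg.1 (congrFun₂ h2.symm a b)⟩

/-- At `λ = 0` the frame is block diagonal, `E(x, 0) = diag(A, B)` with `A` orthogonal, and so is
its inverse `diag(Aᵀ, D)`. -/
theorem IsExtendedFrame.blocks_at_zero (hE : IsExtendedFrame k O ξ E) (hx : x ∈ O) :
    E x 0 = Matrix.fromBlocks (E x 0).toBlocks₁₁ 0 0 (E x 0).toBlocks₂₂ ∧
    (E x 0)⁻¹ = Matrix.fromBlocks (E x 0).toBlocks₁₁ᵀ 0 0 (E x 0)⁻¹.toBlocks₂₂ ∧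
    (E x 0).toBlocks₁₁ᵀ * (E x 0).toBlocks₁₁ = 1 ∧
    (E x 0)⁻¹.toBlocks₂₂ * (E x 0).toBlocks₂₂ = 1 := by
  obtain ⟨h1, h2⟩ := hE.offDiag_eq_zero hx
  have hb : E x 0 = Matrix.fromBlocks (E x 0).toBlocks₁₁ 0 0 (E x 0).toBlocks₂₂ := by
    conv_lhs => rw [← Matrix.fromBlocks_toBlocks (E x 0), h1, h2]
  have hinv : (E x 0)⁻¹ = Matrix.fromBlocks (E x 0).toBlocks₁₁ᵀ 0 0
      ((matJ n k).map Complex.ofReal * (E x 0).toBlocks₂₂ᵀ * (matJ n k).map Complex.ofReal) := by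
    rw [hE.inv_eq hx]
    conv_lhs => rw [hb]
    simp [gramMat, Matrix.fromBlocks_transpose, Matrix.fromBlocks_multiply]
  have hinv' : (E x 0)⁻¹ =
      Matrix.fromBlocks (E x 0).toBlocks₁₁ᵀ 0 0 (E x 0)⁻¹.toBlocks₂₂ := by
    conv_rhs => rw [hinv, Matrix.toBlocks_fromBlocks₂₂]
    exact hinv
  have hmul : Matrix.fromBlocks (E x 0).toBlocks₁₁ᵀ 0 0 (E x 0)⁻¹.toBlocks₂₂ *
      Matrix.fromBlocks (E x 0).toBlocks₁₁ 0 0 (E x 0).toBlocks₂₂ = 1 := by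
    rw [← hb, ← hinv', hE.inv_mul hx 0]
  rw [Matrix.fromBlocks_multiply, ← Matrix.fromBlocks_one, Matrix.fromBlocks_inj] at hmul
  simp only [Matrix.zero_mul, Matrix.mul_zero, add_zero, zero_add] at hmul
  exact ⟨hb, hinv', hmul.1, hmul.2.2.2⟩

/-- With `E(x, 0) = diag(A, B)` and `E(x, 0)⁻¹ = diag(Aᵀ, D)`, the derivative `∂Y/∂xᵢ` is, up to a
sign, the product of column `i` of `A` and row `i` of `D`. -/
theorem IsExtendedFrame.conj_aElem_apply (hE : IsExtendedFrame k O ξ E) (hx : x ∈ O) (i : Fin n)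
    (p : Fin (n + 1)) (q : Fin n) :
    (E x 0 * (aElem k i).map Complex.ofReal * (E x 0)⁻¹).toBlocks₁₂ p q =
      -(sgnK k i : ℂ) * ((E x 0).toBlocks₁₁ p i.castSucc * (E x 0)⁻¹.toBlocks₂₂ i q) := by
  obtain ⟨h1, h2, -, -⟩ := hE.blocks_at_zero hx
  have ha : (aElem k i).map Complex.ofReal = Matrix.fromBlocks 0
      (-(sgnK k i : ℂ) • Matrix.single i.castSucc i (1 : ℂ)) (Matrix.single i i.castSucc 1) 0 := by
    rw [aElem, pElem, Matrix.fromBlocks_map]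
    ext (a | a) (b | b)
    · simp
    · simp only [matJ, Matrix.map_apply, Matrix.fromBlocks_apply₁₂, Matrix.neg_apply,
        Matrix.mul_diagonal, Matrix.transpose_apply, Matrix.single_apply, Matrix.smul_apply]
      by_cases hb : i = b
      · subst hb
        by_cases ha : i.castSucc = a <;> simp [ha]
      · simp [hb]
    · simp only [Matrix.map_apply, Matrix.fromBlocks_apply₂₁, Matrix.single_apply]
      split_ifs <;> simp
    · simp
  have : E x 0 * (aElem k i).map Complex.ofReal * (E x 0)⁻¹ =
      Matrix.fromBlocks (E x 0).toBlocks₁₁ 0 0 (E x 0).toBlocks₂₂ *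
        (aElem k i).map Complex.ofReal *
        Matrix.fromBlocks (E x 0).toBlocks₁₁ᵀ 0 0 (E x 0)⁻¹.toBlocks₂₂ := by
    rw [← h1, ← h2]
  rw [this, ha, Matrix.fromBlocks_multiply, Matrix.fromBlocks_multiply,
    Matrix.toBlocks_fromBlocks₁₂]
  simp [Matrix.mul_apply, Matrix.single_apply, ite_and]
  ring

end ExtendedFrame

/-! ### Uniqueness of the frame and of the basis -/

section RankOne

/-- A nonzero product `a bᵀ` with `a` of unit length determines `a` and `b` up to a common sign.
No positivity is used, so this holds over `ℂ` with its bilinear dot product. -/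
theorem rankOne_sign {ι κ : Type*} [Fintype ι] [Fintype κ] {a a' : ι → ℂ} {b b' β : κ → ℂ}
    (h : ∀ p q, a p * b q = a' p * b' q) (ha : a ⬝ᵥ a = 1) (ha' : a' ⬝ᵥ a' = 1)
    (hβ : b ⬝ᵥ β = 1) :
    (a ⬝ᵥ a') ^ 2 = 1 ∧ (a ⬝ᵥ a' = 1 → a = a' ∧ b = b') := by
  have h1 : a = (b' ⬝ᵥ β) • a' := by
    funext p
    calc a p = a p * (b ⬝ᵥ β) := by rw [hβ, mul_one]
      _ = (b' ⬝ᵥ β) * a' p := by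
        simp only [dotProduct, Finset.mul_sum, Finset.sum_mul]
        exact Finset.sum_congr rfl fun q _ => by rw [← mul_assoc, h]; ring
  have h2 : a ⬝ᵥ a' = b' ⬝ᵥ β := by
    conv_lhs => rw [h1, smul_dotProduct, ha', smul_eq_mul, mul_one]
  have h3 : (a ⬝ᵥ a') ^ 2 = 1 := by
    have := ha
    conv_lhs at this => rw [h1, smul_dotProduct, dotProduct_smul, ha', ← h2]
    simpa [sq] using this
  refine ⟨h3, fun hs => ?_⟩
  have haa : a = a' := by rw [h1, ← h2, hs, one_smul]
  refine ⟨haa, funext fun q => ?_⟩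
  calc b q = ∑ p, a p * a p * b q := by
        rw [← Finset.sum_mul]; exact (by rw [← dotProduct, ha, one_mul])
    _ = ∑ p, a p * a p * b' q := Finset.sum_congr rfl fun p _ => by rw [mul_assoc, h, ← haa]; ring
    _ = b' q := by rw [← Finset.sum_mul]; exact (by rw [← dotProduct, ha, one_mul])

theorem col_dotProduct_col {m : ℕ} {A B : Matrix (Fin m) (Fin m) ℂ} (i j : Fin m) :
    (fun p => A p i) ⬝ᵥ (fun p => B p j) = (Aᵀ * B) i j := rfl

/-- Two orthogonal matrices that agree in all columns but the last agree in the last one up to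
sign. -/
theorem lastCol_sign {n : ℕ} {A A' : Matrix (Fin (n + 1)) (Fin (n + 1)) ℂ} (hA : Aᵀ * A = 1)
    (hA' : A'ᵀ * A' = 1) (h : ∀ i : Fin n, ∀ p, A p i.castSucc = A' p i.castSucc) :
    ((Aᵀ * A') (Fin.last n) (Fin.last n)) ^ 2 = 1 ∧
      ((Aᵀ * A') (Fin.last n) (Fin.last n) = 1 → A = A') := by
  set s := (Aᵀ * A') (Fin.last n) (Fin.last n) with hs
  have h1 : ∀ p, A' p (Fin.last n) = s * A p (Fin.last n) := by
    intro p
    -- Expand the last column of `A'` in the orthonormal basis of columns of `A`.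
    have hexp : A' = A * (Aᵀ * A') := by
      rw [← Matrix.mul_assoc, mul_eq_one_comm.1 hA, Matrix.one_mul]
    have hz : ∀ i : Fin n, (Aᵀ * A') i.castSucc (Fin.last n) = 0 := by
      intro i
      have : (Aᵀ * A') i.castSucc (Fin.last n) = (A'ᵀ * A') i.castSucc (Fin.last n) := by
        simp [Matrix.mul_apply, h]
      rw [this, hA', Matrix.one_apply_ne (Fin.castSucc_lt_last i).ne]
    conv_lhs => rw [hexp, Matrix.mul_apply, Fin.sum_univ_castSucc]
    simp [hz, ← hs, mul_comm]
  have h2 : s ^ 2 = 1 := by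
    have h3 := congrFun₂ hA' (Fin.last n) (Fin.last n)
    have h4 := congrFun₂ hA (Fin.last n) (Fin.last n)
    simp only [Matrix.mul_apply, Matrix.transpose_apply, Matrix.one_apply_eq, h1] at h3 h4
    calc s ^ 2 = s ^ 2 * ∑ p, A p (Fin.last n) * A p (Fin.last n) := by rw [h4, mul_one]
      _ = 1 := by
        rw [← h3, Finset.mul_sum]
        exact Finset.sum_congr rfl fun p _ => by ring
  refine ⟨h2, fun hs1 => Matrix.ext fun p j => ?_⟩
  induction j using Fin.lastCases with
  | last => rw [h1, hs1, one_mul]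
  | cast i => exact h i p

theorem eq_one_of_sq_eq_one {X : Type*} [TopologicalSpace X] {O : Set X} (hO : IsPreconnected O)
    {φ : X → ℂ} (hφ : ContinuousOn φ O) (hsq : ∀ x ∈ O, φ x ^ 2 = 1) {x₀ : X} (hx₀ : x₀ ∈ O)
    (h₀ : φ x₀ = 1) {x : X} (hx : x ∈ O) : φ x = 1 := by
  rcases hO.eq_one_or_eq_neg_one_of_sq_eq hφ hsq with h | h
  · exact h hx
  · have := h hx₀
    rw [h₀] at this
    norm_num at this

end RankOne

section Uniqueness

variable {n k : ℕ}

theorem IsExtendedFrame.continuousOn_gram {O : Set (Euc n)}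
    {ξ ξ' : Euc n → Matrix (Fin n) (Fin (n + 1)) ℝ} {E E' : Euc n → ℂ → Matrix (Idx n) (Idx n) ℂ}
    (hE : IsExtendedFrame k O ξ E) (hE' : IsExtendedFrame k O ξ' E') (i j : Fin (n + 1)) :
    ContinuousOn (fun x => ((E x 0).toBlocks₁₁ᵀ * (E' x 0).toBlocks₁₁) i j) O := by
  have hcont : ∀ {ξ : Euc n → Matrix (Fin n) (Fin (n + 1)) ℝ}
      {E : Euc n → ℂ → Matrix (Idx n) (Idx n) ℂ} (_ : IsExtendedFrame k O ξ E) a b,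
      ContinuousOn (fun x => E x 0 a b) O := fun hE a b =>
    (hE.smooth a b).continuousOn.comp (f := fun y : Euc n => (y, (0 : ℂ)))
      (by fun_prop) fun y hy => ⟨hy, trivial⟩
  simp only [Matrix.mul_apply]
  exact continuousOn_finsetSum _ fun p _ => (hcont hE _ _).mul (hcont hE' _ _)

/-- Frames with the same `Y` and the same value at a base point agree at `λ = 0`. The derivatives
of `Y` give all columns of `A` but one and all rows of `D`, each up to a sign, and the signs are
constant because the domain is connected. -/
theorem IsExtendedFrame.eq_at_zero {O : Set (Euc n)} (hO : IsOpen O) (hc : IsPreconnected O)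
    {ξ ξ' : Euc n → Matrix (Fin n) (Fin (n + 1)) ℝ} {E E' : Euc n → ℂ → Matrix (Idx n) (Idx n) ℂ}
    (hE : IsExtendedFrame k O ξ E) (hE' : IsExtendedFrame k O ξ' E') {x₀ : Euc n} (hx₀ : x₀ ∈ O)
    (h₀ : E x₀ 0 = E' x₀ 0) (hY : ∀ x ∈ O, frameY E x = frameY E' x) {x : Euc n} (hx : x ∈ O) :
    E x 0 = E' x 0 := by
  have hrank : ∀ x ∈ O, ∀ i : Fin n, ∀ p q,
      (E x 0).toBlocks₁₁ p i.castSucc * (E x 0)⁻¹.toBlocks₂₂ i q =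
        (E' x 0).toBlocks₁₁ p i.castSucc * (E' x 0)⁻¹.toBlocks₂₂ i q := by
    intro x hx i p q
    have h := congrFun₂ ((hE.hasMatPd_frameY hO hx i).eq_of_eqOn hO hx
      (hE'.hasMatPd_frameY hO hx i) hY) p q
    rw [hE.conj_aElem_apply hx, hE'.conj_aElem_apply hx] at h
    exact mul_left_cancel₀ (neg_ne_zero.2 (Complex.ofReal_ne_zero.2 (sgnK_ne_zero k i))) h
  have hone : ∀ j, ((E x₀ 0).toBlocks₁₁ᵀ * (E' x₀ 0).toBlocks₁₁) j j = 1 := fun j => by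
    rw [← h₀, (hE.blocks_at_zero hx₀).2.2.1, Matrix.one_apply_eq]
  have hsign : ∀ x ∈ O, ∀ i : Fin n, _ := fun x hx i =>
    rankOne_sign (a := fun p => (E x 0).toBlocks₁₁ p i.castSucc)
      (a' := fun p => (E' x 0).toBlocks₁₁ p i.castSucc)
      (b := fun q => (E x 0)⁻¹.toBlocks₂₂ i q) (b' := fun q => (E' x 0)⁻¹.toBlocks₂₂ i q)
      (β := fun q => (E x 0).toBlocks₂₂ q i) (hrank x hx i)
      (by rw [col_dotProduct_col, (hE.blocks_at_zero hx).2.2.1, Matrix.one_apply_eq])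
      (by rw [col_dotProduct_col, (hE'.blocks_at_zero hx).2.2.1, Matrix.one_apply_eq])
      ((congrFun₂ (hE.blocks_at_zero hx).2.2.2 i i).trans (Matrix.one_apply_eq i))
  have hcol : ∀ x ∈ O, ∀ i : Fin n, _ := fun x hx i =>
    (hsign x hx i).2 (eq_one_of_sq_eq_one hc (hE.continuousOn_gram hE' i.castSucc i.castSucc)
      (fun y hy => (hsign y hy i).1) hx₀ (hone _) hx)
  have hlast : ∀ x ∈ O, _ := fun x hx =>
    lastCol_sign (hE.blocks_at_zero hx).2.2.1 (hE'.blocks_at_zero hx).2.2.1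
      fun i => congrFun (hcol x hx i).1
  have hA : (E x 0).toBlocks₁₁ = (E' x 0).toBlocks₁₁ :=
    (hlast x hx).2 (eq_one_of_sq_eq_one hc
      (hE.continuousOn_gram hE' (Fin.last n) (Fin.last n)) (fun y hy => (hlast y hy).1) hx₀
      (hone _) hx)
  have hD : (E x 0)⁻¹.toBlocks₂₂ = (E' x 0)⁻¹.toBlocks₂₂ :=
    Matrix.ext fun i q => congrFun (hcol x hx i).2 q
  have hinv : (E x 0)⁻¹ = (E' x 0)⁻¹ := by
    rw [(hE.blocks_at_zero hx).2.1, (hE'.blocks_at_zero hx).2.1, hA, hD]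
  rw [← Matrix.mul_one (E x 0), ← hE'.inv_mul hx 0, ← hinv, ← Matrix.mul_assoc, hE.mul_inv hx,
    Matrix.one_mul]

/-- The frame at `λ = 0` determines the connection form `∑ [aᵢ, v] dxᵢ`, hence the Lax pair for all
`λ`; parallel frames of the same Lax pair that agree at one point agree everywhere. -/
theorem IsExtendedFrame.eq_of_eq_at_zero {O : Set (Euc n)} (hO : IsOpen O)
    (hc : IsPreconnected O) {ξ ξ' : Euc n → Matrix (Fin n) (Fin (n + 1)) ℝ}
    {E E' : Euc n → ℂ → Matrix (Idx n) (Idx n) ℂ}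
    (hE : IsExtendedFrame k O ξ E) (hE' : IsExtendedFrame k O ξ' E') {x₀ : Euc n} (hx₀ : x₀ ∈ O)
    (h₀ : E x₀ = E' x₀) (h : ∀ x ∈ O, E x 0 = E' x 0) {x : Euc n} (hx : x ∈ O) :
    E x = E' x := by
  have hlax : ∀ x ∈ O, ∀ i lam, laxCoeff k (ξ x) i lam = laxCoeff k (ξ' x) i lam := by
    intro x hx i lam
    have h1 := (hE.hasMatPd hO hx 0 i).eq_of_eqOn hO hx (hE'.hasMatPd hO hx 0 i) h
    have h2 := congrArg ((E x 0)⁻¹ * ·) h1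
    simp only [← Matrix.mul_assoc] at h2
    rw [← h x hx, hE.inv_mul hx, Matrix.one_mul, Matrix.one_mul] at h2
    rw [laxCoeff_eq_add, h2, ← laxCoeff_eq_add]
  funext lam
  have hconst := eq_of_hasMatPd_zero hO hc (M := fun y => E' y lam * (E y lam)⁻¹) (x₀ := x₀)
    (fun y hy i => by
      have := (hE'.hasMatPd hO hy lam i).mul (hE.hasMatPd_inv hO hy lam i)
      rwa [hlax y hy, Matrix.mul_neg, Matrix.mul_assoc, add_neg_cancel] at this) hx₀ hx
  simp only [← h₀, hE.mul_inv hx₀] at hconst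
  rw [← Matrix.one_mul (E x lam), ← hconst, Matrix.mul_assoc, hE.inv_mul hx, Matrix.mul_one]

/-- The matrix with columns `c₁, …, c_n`. -/
noncomputable def colMatrix (c : Fin n → Fin n → ℝ) : Matrix (Fin n) (Fin n) ℂ :=
  Matrix.of fun j l => (c l j : ℂ)

theorem colMatrix_injective : Function.Injective (colMatrix (n := n)) := fun _ _ h => by
  funext l j
  exact Complex.ofReal_injective (congrFun₂ h j l)

theorem IsNullBasis.isUnit_det_colMatrix {c : Fin n → Fin n → ℝ} (hc : IsNullBasis k c) :
    IsUnit (colMatrix c).det := by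
  have h1 : IsUnit (Matrix.of c) := Matrix.linearIndependent_rows_iff_isUnit.1 hc.1
  have h2 := (h1.map (Complex.ofRealHom.mapMatrix (m := Fin n)))
  have h3 : colMatrix c = (Complex.ofRealHom.mapMatrix (Matrix.of c))ᵀ := rfl
  rw [h3, Matrix.det_transpose]
  exact (Matrix.isUnit_iff_isUnit_det _).1 h2

variable {h : Matrix.orthogonalGroup (Fin (n + 1)) ℝ} {f : HSeq n}
  {ξ ξ' : Euc n → Matrix (Fin n) (Fin (n + 1)) ℝ} {E E' : Euc n → ℂ → Matrix (Idx n) (Idx n) ℂ}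
  {c c' : Fin n → Fin n → ℝ}

theorem Generates.frameY_mul_colMatrix (hg : Generates k h f ξ E c) {x : Euc n}
    (hx : x ∈ f.domain) : frameY E x * colMatrix c =
      Matrix.of fun a l => (f.map l x a : ℂ) - (f.map l 0 a : ℂ) := by
  ext a l
  rw [Matrix.of_apply, hg.eq_map l x hx a, add_sub_cancel_left]
  rfl

theorem Generates.initial_eq (hg : Generates k h f ξ E c) (hg' : Generates k h f ξ' E' c') :
    E 0 = E' 0 :=
  funext fun lam => (hg.initial lam).trans (hg'.initial lam).symm

/-- The basis is read off from `∂f_l/∂xᵢ (0)`, because the frame at `0` is prescribed. -/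
theorem Generates.basis_unique (hO : IsOpen f.domain) (h0 : 0 ∈ f.domain)
    (hg : Generates k h f ξ E c) (hg' : Generates k h f ξ' E' c') : c = c' := by
  obtain ⟨-, -, hA, hD⟩ := hg.frame.blocks_at_zero h0
  have hpd : ∀ i, _ := fun i =>
    ((hg.frame.hasMatPd_frameY hO h0 i).mul (hasMatPd_const (colMatrix c) i 0)).eq_of_eqOn hO h0
      ((hg'.frame.hasMatPd_frameY hO h0 i).mul (hasMatPd_const (colMatrix c') i 0)) fun y hy => by
        rw [hg.frameY_mul_colMatrix hy, hg'.frameY_mul_colMatrix hy]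
  have hDC : (E 0 0)⁻¹.toBlocks₂₂ * colMatrix c = (E 0 0)⁻¹.toBlocks₂₂ * colMatrix c' := by
    ext i l
    have hmul : ∀ (C : Matrix (Fin n) (Fin n) ℂ) p,
        ((E 0 0 * (aElem k i).map Complex.ofReal * (E 0 0)⁻¹).toBlocks₁₂ * C) p l =
          -(sgnK k i : ℂ) *
            ((E 0 0).toBlocks₁₁ p i.castSucc * ((E 0 0)⁻¹.toBlocks₂₂ * C) i l) := by
      intro C p
      rw [Matrix.mul_apply, Matrix.mul_apply, Finset.mul_sum, Finset.mul_sum]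
      refine Finset.sum_congr rfl fun q _ => ?_
      rw [hg.frame.conj_aElem_apply h0]
      ring
    have hent : ∀ p, (E 0 0).toBlocks₁₁ p i.castSucc * ((E 0 0)⁻¹.toBlocks₂₂ * colMatrix c) i l =
        (E 0 0).toBlocks₁₁ p i.castSucc * ((E 0 0)⁻¹.toBlocks₂₂ * colMatrix c') i l := by
      intro p
      have h1 := congrFun₂ (hpd i) p l
      rw [← hg.initial_eq hg', Matrix.mul_zero, Matrix.mul_zero, add_zero, add_zero] at h1
      rw [hmul, hmul] at h1
      exact mul_left_cancel₀
        (neg_ne_zero.2 (Complex.ofReal_ne_zero.2 (sgnK_ne_zero k i))) h1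
    have hsum := congrFun₂ hA i.castSucc i.castSucc
    rw [Matrix.mul_apply, Matrix.one_apply_eq] at hsum
    rw [← one_mul (((E 0 0)⁻¹.toBlocks₂₂ * colMatrix c) i l),
      ← one_mul (((E 0 0)⁻¹.toBlocks₂₂ * colMatrix c') i l), ← hsum, Finset.sum_mul,
      Finset.sum_mul]
    exact Finset.sum_congr rfl fun p _ => by rw [mul_assoc, hent, mul_assoc]
  apply colMatrix_injective
  have h2 := congrArg ((E 0 0).toBlocks₂₂ * ·) hDC
  simpa only [← Matrix.mul_assoc, mul_eq_one_comm.1 hD, Matrix.one_mul] using h2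

theorem Generates.frame_unique (hO : IsOpen f.domain) (hc : IsPreconnected f.domain)
    (h0 : 0 ∈ f.domain) (hg : Generates k h f ξ E c) (hg' : Generates k h f ξ' E' c')
    {x : Euc n} (hx : x ∈ f.domain) : E x = E' x := by
  have hE0 := hg.initial_eq hg'
  have hY : ∀ y ∈ f.domain, frameY E y = frameY E' y := by
    intro y hy
    have h1 := (hg.frameY_mul_colMatrix hy).trans (hg'.frameY_mul_colMatrix hy).symm
    rw [← hg.basis_unique hO h0 hg'] at h1
    have h2 := congrArg (· * (colMatrix c)⁻¹) h1
    simpa only [Matrix.mul_nonsing_inv_cancel_right _ _ hg.nullBasis.isUnit_det_colMatrix] using h2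
  exact hg.frame.eq_of_eq_at_zero hO hc hg'.frame h0 hE0
    (fun y hy => hg.frame.eq_at_zero hO hc hg'.frame h0 (congrFun hE0 0) hY hy) hx

theorem frameY_dressedFrame_congr {α : ℂ} {v : Idx n → ℂ} {x : Euc n} (hx : E x = E' x) :
    frameY (dressedFrame k α v E) x = frameY (dressedFrame k α v E') x := by
  simp only [frameY, dressedFrame, movedLine, hx]

theorem ribaucour_single_valued {α : ℂ} {v : Idx n → ℂ} (hf : IsCombescure k f)
    (h0 : 0 ∈ f.domain) {g g' : HSeq n} (hg : g ∈ ribaucour k α v h f)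
    (hg' : g' ∈ ribaucour k α v h f) {x : Euc n} (hx : x ∈ g.domain) (hx' : x ∈ g'.domain)
    (l : Fin n) : g.map l x = g'.map l x := by
  obtain ⟨-, hdom, ξ, E, c, hgen, hval⟩ := hg
  obtain ⟨-, -, ξ', E', c', hgen', hval'⟩ := hg'
  have := hf.simplyConnected
  have hc : IsPreconnected f.domain := isPreconnected_iff_preconnectedSpace.2 inferInstance
  ext a
  apply Complex.ofReal_injective
  rw [(hval x hx).2, (hval' x hx').2, hgen.basis_unique hf.isOpen h0 hgen',
    frameY_dressedFrame_congr (hgen.frame_unique hf.isOpen hc h0 hgen' (hdom hx))]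

end Uniqueness

theorem mainTheorem12 (n k : ℕ) (hk : 1 ≤ k) (hkn : k < n) (r : ℝ) (hr : 0 < r)
    (α : ℂ) (v : Idx n → ℂ) (hv : IsAdmissible k α v)
    (h : Matrix.orthogonalGroup (Fin (n + 1)) ℝ)
    (f : HSeq n) (hf : IsCombescure k f) (hf0 : (0 : Euc n) ∈ f.domain) :
    IsCombescure k (lieTransform r f) ∧
    IsAdmissible k ((r : ℂ)⁻¹ * α) v ∧
    lieTransform r '' ribaucour k α v h (lieTransform r⁻¹ f) =
      ribaucour k ((r : ℂ)⁻¹ * α) v h f ∧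
    ∀ g ∈ ribaucour k α v h f, ∀ g' ∈ ribaucour k α v h f,
      ∀ x ∈ g.domain ∩ g'.domain, ∀ l, g.map l x = g'.map l x :=
  ⟨hf.lieTransform hr.ne',
    by simpa only [Complex.ofReal_inv] using hv.real_mul (inv_ne_zero hr.ne'),
    lieTransform_image_ribaucour hr.ne',
    fun _ hg _ hg' _ hx l => ribaucour_single_valued hf hf0 hg hg' hx.1 hx.2 l⟩
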